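/- For $c\in\mathbb C$ and $n\in\mathbb Z$ let $(c)_n=\Gamma(c+n)/\Gamma(c)$ (understood as a limit when $c\in\{0,-1,-2,\dots\}$), i.e. $(c)_n=\prod_{k=0}^{n-1}(c+k)$ for $n\ge 0$ and $(c)_{-n}=\prod_{k=1}^{n}(c-k)^{-1}$ for $n\ge1$. The bilateral hypergeometric series is $${}_mH_m\!\left({\alpha_1,\dots,\alpha_m\atop \beta_1,\dots,\beta_m};z\right)=\sum_{n=-\infty}^{\infty}\frac{(\alpha_1)_n\cdots(\alpha_m)_n}{(\beta_1)_n\cdots(\beta_m)_n}\,z^n .$$ It is well defined if no $\beta_j$ is in $\{0,-1,-2,\dots\}$ and no $\alpha_j$ is in $\{1,2,\dots\}$. More generally, a parameter $\beta_j=-k$ with $k\ge0$ is allowed if some $\alpha_i=-m$ with $0\le m\le k$ (the series is then taken to terminate on the right, its terms with $n>m$ being $0$), and a parameter $\alpha_j=k$ with $k\ge1$ is allowed if some $\beta_i=m$ with $1\le m\le k$ (the series is then taken to terminate on the left, its terms with $n\le -m$ being $0$). The convention $1/\Gamma(w)=0$ for $w\in\{0,-1,-2,\dots\}$ is used. **Theorem.**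 (i) Let $c_1,c_2,c_3\in\mathbb C$ with $\Re(1+c_1+c_2+c_3)>0$, such that the bilateral series below is well defined. Then the following integral and series converge absolutely, and $$\int_{-\infty}^\infty\frac{dy}{\prod_{j=1}^3\Gamma(1+c_j+y)\Gamma(1+c_j-y)}=\frac{1}{\prod_{j=1}^3\Gamma(c_j+\frac54)\Gamma(c_j+\frac34)}\;{}_3H_3\!\left({\frac14-c_1,\frac14-c_2,\frac14-c_3\atop \frac54+c_1,\frac54+c_2,\frac54+c_3};-1\right).$$ (ii) Let $c_1,c_2,c_3,c_4\in\mathbb C$ with $\Re(c_1+c_2+c_3+c_4)>-\frac32$, such that the bilateral series below is well defined. Then the following integral and series converge absolutely, and $$\int_{-\infty}^\infty\frac{dy}{\prod_{j=1}^4\Gamma(1+c_j+y)\Gamma(1+c_j-y)}=\frac{1}{\prod_{j=1}^4\Gamma(c_j+\frac54)\Gamma(c_j+\frac34)}\;{}_4H_4\!\left({\frac14-c_1,\dots,\frac14-c_4\atop \frac54+c_1,\dots,\frac54+c_4};1\right).$$ -/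

import Mathlib

open Finset

/-- The shifted factorial `(c)_n` for an integer `n`: for `n ≥ 0` it is `c (c+1) ⋯ (c+n-1)`, and
`(c)_{-n} = 1 / ((c-1) (c-2) ⋯ (c-n))`. It equals `Γ(c+n)/Γ(c)` whenever the latter makes sense
(`shiftedFactorial_eq_Gamma_div_Gamma`); the product form also covers `c = 0, -1, -2, …`, where
the quotient of Gamma functions is read as a limit. For `c ∈ {1, …, n}` the symbol `(c)_{-n}`
is infinite; the value here is then `0` by convention. -/
noncomputable def shiftedFactorial (c : ℂ) : ℤ → ℂ
  | Int.ofNat n => ∏ k ∈ range n, (c + (k : ℂ))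
  | Int.negSucc n => (∏ k ∈ range (n + 1), (c - ((k : ℂ) + 1)))⁻¹

theorem Gamma_add_natCast_eq_prod (c : ℂ) (n : ℕ) (hc : ∀ k : ℕ, c ≠ -(k : ℂ)) :
    Complex.Gamma (c + n) = (∏ k ∈ range n, (c + (k : ℂ))) * Complex.Gamma c := by
  induction n with
  | zero => simp
  | succ n ih =>
    have h : c + (n : ℂ) ≠ 0 := fun h => hc n (eq_neg_of_add_eq_zero_left h)
    rw [prod_range_succ, Nat.cast_succ, ← add_assoc, Complex.Gamma_add_one _ h, ih]
    ring

theorem shiftedFactorial_eq_Gamma_div_Gamma (c : ℂ) (n : ℤ) (hc : ∀ k : ℕ, c ≠ -(k : ℂ))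
    (hcn : ∀ k : ℕ, c + (n : ℂ) ≠ -(k : ℂ)) :
    shiftedFactorial c n = Complex.Gamma (c + n) / Complex.Gamma c := by
  have h0 := Complex.Gamma_ne_zero hc
  have h1 := Complex.Gamma_ne_zero hcn
  cases n with
  | ofNat n =>
    have h := Gamma_add_natCast_eq_prod c n hc
    simp only [shiftedFactorial, Int.ofNat_eq_natCast, Int.cast_natCast]
    rw [h, mul_div_cancel_right₀ _ h0]
  | negSucc n =>
    have h := Gamma_add_natCast_eq_prod (c + ((Int.negSucc n : ℤ) : ℂ)) (n + 1) hcn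
    have e : c + ((Int.negSucc n : ℤ) : ℂ) + ((n + 1 : ℕ) : ℂ) = c := by
      rw [Int.cast_negSucc]; ring
    rw [e] at h
    have hp : ∏ k ∈ range (n + 1), (c + ((Int.negSucc n : ℤ) : ℂ) + (k : ℂ))
        = ∏ k ∈ range (n + 1), (c - ((k : ℂ) + 1)) := by
      rw [← prod_range_reflect]
      refine prod_congr rfl fun k hk => ?_
      have hk' : k ≤ n := Nat.lt_succ_iff.mp (mem_range.mp hk)
      rw [show n + 1 - 1 - k = n - k by omega, Nat.cast_sub hk', Int.cast_negSucc]
      push_cast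
      ring
    rw [hp] at h
    simp only [shiftedFactorial]
    have hP : ∏ k ∈ range (n + 1), (c - ((k : ℂ) + 1)) ≠ 0 := by
      intro hz
      rw [hz, zero_mul] at h
      exact h0 h
    rw [h]
    field_simp

/-- The `n`-th term, `n ∈ ℤ`, of the bilateral hypergeometric series `ₚH_q(a; b; z)`. -/
noncomputable def bilateralTerm {p q : ℕ} (a : Fin p → ℂ) (b : Fin q → ℂ) (z : ℂ) (n : ℤ) : ℂ :=
  (∏ i, shiftedFactorial (a i) n) / (∏ j, shiftedFactorial (b j) n) * z ^ n

/-- The bilateral hypergeometric series `ₚH_q(a; b; z) = ∑_{n ∈ ℤ} bilateralTerm a b z n`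
(to be used where the series converges absolutely). -/
noncomputable def bilateralH {p q : ℕ} (a : Fin p → ℂ) (b : Fin q → ℂ) (z : ℂ) : ℂ :=
  ∑' n : ℤ, bilateralTerm a b z n

/-- The terms of `ₚH_q(a; b; z)` are well defined. This holds in particular if no `b j` is a
nonpositive integer and no `a i` is a positive integer (`bilateralWellDefined_of_forall_ne`).
More generally, a lower parameter `-k`, `k ≥ 0` (which spoils the terms with `n > k`) is allowed if
the series has terminated on the right by then, because some upper parameter is `-m` with
`0 ≤ m ≤ k` (the terms with `n > m` are zero); and an upper parameter `k ≥ 1` (which spoils the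
terms with `n ≤ -k`) is allowed if the series has terminated on the left by then, because some
lower parameter is `m` with `1 ≤ m ≤ k` (the terms with `n ≤ -m` are zero). -/
def BilateralWellDefined {p q : ℕ} (a : Fin p → ℂ) (b : Fin q → ℂ) : Prop :=
  (∀ j, ∀ k : ℕ, b j = -(k : ℂ) → ∃ i, ∃ m : ℕ, m ≤ k ∧ a i = -(m : ℂ)) ∧
  (∀ i, ∀ k : ℕ, 1 ≤ k → a i = (k : ℂ) → ∃ j, ∃ m : ℕ, 1 ≤ m ∧ m ≤ k ∧ b j = (m : ℂ))

theorem bilateralWellDefined_of_forall_ne {p q : ℕ} (a : Fin p → ℂ) (b : Fin q → ℂ)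
    (hb : ∀ j, ∀ k : ℕ, b j ≠ -(k : ℂ)) (ha : ∀ i, ∀ k : ℕ, 1 ≤ k → a i ≠ (k : ℂ)) :
    BilateralWellDefined a b :=
  ⟨fun j k h => absurd h (hb j k), fun i k hk h => absurd h (ha i k hk)⟩

/-! ### Power bounds for a quotient of Gamma functions -/

section GammaBounds

open Complex MeasureTheory

/-! Let F(z) be the product over j of 1/(Γ(1+c_j+z)Γ(1+c_j-z)). It is entire and even, has
exponential type at most mπ, and on the real line is O((1+|x|)^(-p)) with p = m + 2 Re ∑ c_j. The
hypotheses on the c_j say exactly that p > 1. Poisson summation expresses the sum of F over 1/4 + ℤ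
through the Fourier coefficients F̂(k), weighted by i^k. Moving the contour (Paley–Wiener) gives
F̂(k) = 0 once 2π|k| ≥ mπ and k ≠ 0, so for m ≤ 4 only k = 0, ±1 can survive. Evenness gives F̂(1) =
F̂(-1), and their weights i and -i cancel, leaving F̂(0) = ∫ F: this is
`tsum_quarter_add_int_eq_integral`. By the reflection of shifted factorials, F(1/4 + n) is the Gamma
prefactor times the n-th term of the bilateral series (`prod_invGammaPair_quarter_add_int`). The
analytic input is the growth bound `exists_norm_invGammaPair_le`, valid in the whole plane and built
from the Beta integral. -/

theorem norm_betaIntegral_le {u v : ℂ} (hu : 1 < u.re) (hv : 0 < v.re) :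
    ‖betaIntegral u v‖ ≤ Real.Gamma v.re * (u.re - 1) ^ (-v.re) := by
  have hr : 0 < u.re - 1 := by linarith
  have hint : IntegrableOn (fun t : ℝ => t ^ (v.re - 1) * Real.exp (-((u.re - 1) * t)))
      (Set.Ioi 0) := by
    have := integrableOn_rpow_mul_exp_neg_mul_rpow (s := v.re - 1) (p := 1) (by linarith)
      one_pos hr
    simpa only [neg_mul, Real.rpow_one] using this
  rw [← betaIntegral_symm, betaIntegral]
  calc ‖∫ x : ℝ in (0 : ℝ)..1, (x : ℂ) ^ (v - 1) * (1 - (x : ℂ)) ^ (u - 1)‖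
      ≤ ∫ t : ℝ in (0 : ℝ)..1, t ^ (v.re - 1) * Real.exp (-((u.re - 1) * t)) := by
        refine intervalIntegral.norm_integral_le_of_norm_le zero_le_one ?_ ?_
        · refine Filter.Eventually.of_forall fun t ht => ?_
          have h1 : (1 : ℂ) - t = ((1 - t : ℝ) : ℂ) := by push_cast; ring
          rw [norm_mul, norm_cpow_eq_rpow_re_of_pos ht.1, sub_re, one_re]
          refine mul_le_mul_of_nonneg_left ?_ (Real.rpow_nonneg ht.1.le _)
          have h0 : 0 ≤ 1 - t := by linarith [ht.2]
          rw [h1, norm_cpow_eq_rpow_re_of_nonneg h0 (by simpa using hr.ne')]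
          -- The inequality 1 - t ≤ exp(-t) compares the Beta integral with a Gamma integral.
          calc (1 - t) ^ (u - 1).re ≤ (Real.exp (-t)) ^ (u - 1).re := by
                refine Real.rpow_le_rpow h0 ?_ (by simpa using hr.le)
                linarith [Real.add_one_le_exp (-t)]
            _ = _ := by
                rw [← Real.exp_mul]
                congr 1
                simp
                ring
        · rw [intervalIntegrable_iff_integrableOn_Ioc_of_le zero_le_one]
          exact hint.mono_set Set.Ioc_subset_Ioi_self
    _ ≤ ∫ t in Set.Ioi (0 : ℝ), t ^ (v.re - 1) * Real.exp (-((u.re - 1) * t)) := by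
        rw [intervalIntegral.integral_of_le zero_le_one]
        refine setIntegral_mono_set hint ?_ Set.Ioc_subset_Ioi_self.eventuallyLE
        filter_upwards [ae_restrict_mem measurableSet_Ioi] with t ht
        exact mul_nonneg (Real.rpow_nonneg (le_of_lt ht) _) (Real.exp_pos _).le
    _ = _ := by
        rw [Real.integral_rpow_mul_exp_neg_mul_Ioi hv hr, one_div, Real.inv_rpow hr.le,
          Real.rpow_neg hr.le, mul_comm]

/-- The quotient equals B(z - c, 1 + 2c)/Γ(1 + 2c). Convergence of this Beta integral requires Re(1
+ 2c) > 0, and the resulting bound is uniform in Im z. -/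
theorem exists_norm_Gamma_div_Gamma_le_of_re_gt (c : ℂ) (hc : -(1 / 2) < c.re) :
    ∃ C X : ℝ, 0 ≤ C ∧ 1 ≤ X ∧ ∀ z : ℂ, X ≤ z.re →
      ‖Gamma (z - c) / Gamma (z + 1 + c)‖ ≤ C * z.re ^ (-(1 + 2 * c.re)) := by
  have hv : 0 < (1 + 2 * c).re := by simp; linarith
  have hG : Gamma (1 + 2 * c) ≠ 0 := Gamma_ne_zero_of_re_pos hv
  refine ⟨Real.Gamma (1 + 2 * c.re) * 2 ^ (1 + 2 * c.re) / ‖Gamma (1 + 2 * c)‖,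
    2 * (|c.re| + 1) + 1, ?_, ?_, fun z hz => ?_⟩
  · have : 0 < Real.Gamma (1 + 2 * c.re) := Real.Gamma_pos_of_pos (by linarith)
    positivity
  · linarith [abs_nonneg c.re]
  · have h1 := le_abs_self c.re
    have h2 := abs_nonneg c.re
    have h3 := neg_abs_le c.re
    have hz0 : 0 < z.re := by linarith
    have hu : 1 < (z - c).re := by simp; linarith
    have hb := norm_betaIntegral_le hu hv
    have hprod := Gamma_mul_Gamma_eq_betaIntegral (by linarith : 0 < (z - c).re) hv
    have he : z - c + (1 + 2 * c) = z + 1 + c := by ring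
    rw [he] at hprod
    have hG2 : Gamma (z + 1 + c) ≠ 0 := Gamma_ne_zero_of_re_pos (by simp; linarith)
    have hq : Gamma (z - c) / Gamma (z + 1 + c)
        = betaIntegral (z - c) (1 + 2 * c) / Gamma (1 + 2 * c) := by
      rw [div_eq_div_iff hG2 hG, hprod, mul_comm]
    have hre : (1 + 2 * c).re = 1 + 2 * c.re := by simp
    rw [hre] at hb hv
    rw [hq, norm_div, div_mul_eq_mul_div]
    gcongr
    refine hb.trans ?_
    rw [mul_assoc]
    have hGp := Real.Gamma_pos_of_pos hv
    gcongr
    calc ((z - c).re - 1) ^ (-(1 + 2 * c.re)) ≤ (z.re / 2) ^ (-(1 + 2 * c.re)) := by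
          refine Real.rpow_le_rpow_of_nonpos (by positivity) ?_ (by linarith)
          simp; linarith
      _ = _ := by
          rw [Real.div_rpow hz0.le zero_le_two, Real.rpow_neg zero_le_two, div_inv_eq_mul, mul_comm]

/-- Replacing c by c + 1 costs the factor (z - c - 1)(z + 1 + c), at most a constant times ((1 + |Im
z|) Re z)². The power of Re z repairs the exponent and the power of 1 + |Im z| is absorbed in K, so
induction reaches every c. -/
theorem exists_norm_Gamma_div_Gamma_le (c : ℂ) :
    ∃ (C X : ℝ) (K : ℕ), 0 ≤ C ∧ 1 ≤ X ∧ ∀ z : ℂ, X ≤ z.re →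
      ‖Gamma (z - c) / Gamma (z + 1 + c)‖
        ≤ C * (1 + |z.im|) ^ K * z.re ^ (-(1 + 2 * c.re)) := by
  suffices H : ∀ N : ℕ, ∀ c : ℂ, -(1 / 2) - (N : ℝ) < c.re →
      ∃ (C X : ℝ) (K : ℕ), 0 ≤ C ∧ 1 ≤ X ∧ ∀ z : ℂ, X ≤ z.re →
        ‖Gamma (z - c) / Gamma (z + 1 + c)‖
          ≤ C * (1 + |z.im|) ^ K * z.re ^ (-(1 + 2 * c.re)) by
    obtain ⟨N, hN⟩ := exists_nat_gt (-(1 / 2) - c.re)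
    exact H N c (by linarith)
  intro N
  induction N with
  | zero =>
    intro c hc
    obtain ⟨C, X, hC, hX, h⟩ := exists_norm_Gamma_div_Gamma_le_of_re_gt c (by simpa using hc)
    exact ⟨C, X, 0, hC, hX, fun z hz => by simpa using h z hz⟩
  | succ N ih =>
    intro c hc
    obtain ⟨C, X, K, hC, hX, h⟩ := ih (c + 1) (by simp at hc ⊢; linarith)
    refine ⟨(2 + ‖c‖) ^ 2 * C, max X (‖c‖ + 2), K + 2, by positivity,
      le_max_of_le_left hX, fun z hz => ?_⟩
    have hzX := (le_max_left _ _).trans hz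
    have hzc := (le_max_right _ _).trans hz
    have hz1 : 1 ≤ z.re := hX.trans hzX
    have hz0 : 0 < z.re := by linarith
    have hcre := abs_le.1 (abs_re_le_norm c)
    have e1 : Gamma (z - c) = (z - c - 1) * Gamma (z - (c + 1)) := by
      have := Gamma_add_one (z - c - 1) (fun h => by
        have := congrArg re h; simp at this; linarith)
      rw [sub_add_cancel] at this
      rw [this, sub_sub]
    have e2 : Gamma (z + 1 + (c + 1)) = (z + 1 + c) * Gamma (z + 1 + c) := by
      have := Gamma_add_one (z + 1 + c) (fun h => by
        have := congrArg re h; simp at this; linarith)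
      rw [← this, ← add_assoc]
    have hne : z + 1 + c ≠ 0 := fun h => by
      have := congrArg re h; simp at this; linarith
    have e3 : Gamma (z - c) / Gamma (z + 1 + c)
        = (z - c - 1) * (z + 1 + c) * (Gamma (z - (c + 1)) / Gamma (z + 1 + (c + 1))) := by
      have hG2 : Gamma (z + 1 + c) ≠ 0 := Gamma_ne_zero_of_re_pos (by simp; linarith)
      rw [e1, e2]
      field_simp
    have hzn : ‖z‖ ≤ z.re + |z.im| := by
      simpa [abs_of_pos hz0] using norm_le_abs_re_add_abs_im z
    have him := abs_nonneg z.im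
    have hcn := norm_nonneg c
    have hbase : z.re + |z.im| + 1 + ‖c‖ ≤ (2 + ‖c‖) * ((1 + |z.im|) * z.re) := by
      nlinarith [mul_nonneg him (by linarith : 0 ≤ z.re - 1), mul_nonneg hcn him,
        mul_nonneg (mul_nonneg hcn him) hz0.le, mul_nonneg hcn (by linarith : 0 ≤ z.re - 1)]
    have n1 : ‖z - c - 1‖ ≤ (2 + ‖c‖) * ((1 + |z.im|) * z.re) := by
      refine le_trans ?_ hbase
      calc ‖z - c - 1‖ ≤ ‖z - c‖ + ‖(1 : ℂ)‖ := norm_sub_le _ _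
        _ ≤ ‖z‖ + ‖c‖ + 1 := by gcongr; exacts [norm_sub_le _ _, by simp]
        _ ≤ _ := by linarith
    have n2 : ‖z + 1 + c‖ ≤ (2 + ‖c‖) * ((1 + |z.im|) * z.re) := by
      refine le_trans ?_ hbase
      calc ‖z + 1 + c‖ ≤ ‖z‖ + ‖(1 : ℂ)‖ + ‖c‖ := norm_add₃_le
        _ ≤ _ := by rw [norm_one]; linarith
    rw [e3, norm_mul, norm_mul]
    have hpow : z.re ^ (-(1 + 2 * c.re)) = z.re ^ 2 * z.re ^ (-(1 + 2 * (c + 1).re)) := by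
      rw [← Real.rpow_natCast, ← Real.rpow_add hz0]
      congr 1
      simp; ring
    calc ‖z - c - 1‖ * ‖z + 1 + c‖ * ‖Gamma (z - (c + 1)) / Gamma (z + 1 + (c + 1))‖
        ≤ ((2 + ‖c‖) * ((1 + |z.im|) * z.re)) * ((2 + ‖c‖) * ((1 + |z.im|) * z.re)) *
          (C * (1 + |z.im|) ^ K * z.re ^ (-(1 + 2 * (c + 1).re))) := by
            gcongr
            exact h z hzX
      _ = _ := by rw [hpow]; ring

end GammaBounds

/-! ### Growth of 1/(Γ(1+c+z)Γ(1+c-z)) in the whole plane -/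

section InvGammaPair

open Complex

theorem norm_complex_sin_le (w : ℂ) : ‖Complex.sin w‖ ≤ Real.exp |w.im| := by
  have h1 : ‖Complex.exp (-w * I)‖ ≤ Real.exp |w.im| := by
    rw [Complex.norm_exp]
    simpa using le_abs_self w.im
  have h2 : ‖Complex.exp (w * I)‖ ≤ Real.exp |w.im| := by
    rw [Complex.norm_exp]
    simpa using neg_le_abs w.im
  rw [Complex.sin, norm_div, norm_mul, norm_I, mul_one, norm_ofNat, div_le_iff₀ two_pos]
  linarith [norm_sub_le (Complex.exp (-w * I)) (Complex.exp (w * I))]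

theorem rpow_le_rpow_abs_mul_of_comparable {a b L : ℝ} (ha : 0 < a) (hb : 0 < b) (hab : a ≤ L * b)
    (hba : b ≤ L * a) (q : ℝ) : a ^ q ≤ L ^ |q| * b ^ q := by
  have hL : 0 < L := pos_of_mul_pos_left (ha.trans_le hab) hb.le
  rcases le_total 0 q with hq | hq
  · rw [abs_of_nonneg hq, ← Real.mul_rpow hL.le hb.le]
    exact Real.rpow_le_rpow ha.le hab hq
  · rw [abs_of_nonpos hq, Real.rpow_neg hL.le, ← Real.inv_rpow hL.le,
      ← Real.mul_rpow (inv_nonneg.2 hL.le) hb.le]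
    refine Real.rpow_le_rpow_of_nonpos (by positivity) ?_ hq
    rwa [inv_mul_le_iff₀ hL]

/-- The entire function `z ↦ 1 / (Γ(1 + c + z) Γ(1 + c - z))`. -/
noncomputable def invGammaPair (c z : ℂ) : ℂ := (Gamma (1 + c + z) * Gamma (1 + c - z))⁻¹

theorem invGammaPair_neg (c z : ℂ) : invGammaPair c (-z) = invGammaPair c z := by
  rw [invGammaPair, invGammaPair, mul_comm, sub_neg_eq_add, ← sub_eq_add_neg]

theorem differentiable_invGammaPair (c : ℂ) : Differentiable ℂ (invGammaPair c) := by
  have h : invGammaPair c = fun z => (Gamma (1 + c + z))⁻¹ * (Gamma (1 + c - z))⁻¹ := by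
    ext z; rw [invGammaPair, mul_inv]
  rw [h]
  exact (differentiable_one_div_Gamma.comp (differentiable_id.const_add _)).mul
    (differentiable_one_div_Gamma.comp (differentiable_id.const_sub _))

/-- Euler's reflection formula applied to Γ(1 + c - z). The sine carries the exponential type π, and
the quotient carries the power decay. -/
theorem invGammaPair_eq_sin_mul (c z : ℂ) (h : c.re < z.re) :
    invGammaPair c z = Complex.sin (Real.pi * (z - c)) / Real.pi *
      (Gamma (z - c) / Gamma (z + 1 + c)) := by
  have h0 : Gamma (z - c) ≠ 0 := Gamma_ne_zero_of_re_pos (by simpa using h)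
  have hr := Gamma_mul_Gamma_one_sub (z - c)
  have e : Gamma (1 + c - z) = Real.pi / Complex.sin (Real.pi * (z - c)) / Gamma (z - c) := by
    rw [← hr, mul_div_cancel_left₀ _ h0]
    congr 1
    ring
  rw [invGammaPair, e, show z + 1 + c = 1 + c + z by ring, mul_inv, inv_div, div_div_eq_mul_div]
  simp only [div_eq_mul_inv]
  ring_nf

/-- The functional equation is (c - z) P(z) = (1 + c + z) P(z + 1); the ratio of the two linear
factors is bounded because |c - z| ≥ 1. It serves to move points near the imaginary axis into the
half-plane where the Beta bound applies. -/
theorem norm_invGammaPair_le_add_one (c z : ℂ) (h : |c.im| + 1 ≤ |z.im|) :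
    ‖invGammaPair c z‖ ≤ (1 + ‖1 + 2 * c‖) * ‖invGammaPair c (z + 1)‖ := by
  have him : 1 ≤ |(c - z).im| := by
    rw [sub_im, abs_sub_comm]
    linarith [abs_sub_abs_le_abs_sub z.im c.im]
  have hn : 1 ≤ ‖c - z‖ := him.trans (abs_im_le_norm _)
  have hn0 : c - z ≠ 0 := norm_pos_iff.1 (by linarith)
  have e1 : (Gamma (1 + c + z))⁻¹ = (1 + c + z) * (Gamma (1 + c + (z + 1)))⁻¹ := by
    rw [one_div_Gamma_eq_self_mul_one_div_Gamma_add_one, add_assoc (1 + c)]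
  have e2 : (Gamma (1 + c - (z + 1)))⁻¹ = (c - z) * (Gamma (1 + c - z))⁻¹ := by
    rw [show 1 + c - (z + 1) = c - z by ring, one_div_Gamma_eq_self_mul_one_div_Gamma_add_one,
      show c - z + 1 = 1 + c - z by ring]
  have e : (c - z) * invGammaPair c z = (1 + c + z) * invGammaPair c (z + 1) := by
    rw [invGammaPair, invGammaPair, mul_inv, mul_inv, e1, e2]
    ring
  have e' : ‖c - z‖ * ‖invGammaPair c z‖ = ‖1 + c + z‖ * ‖invGammaPair c (z + 1)‖ := by
    rw [← norm_mul, ← norm_mul, e]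
  have hle : ‖1 + c + z‖ ≤ (1 + ‖1 + 2 * c‖) * ‖c - z‖ := by
    calc ‖1 + c + z‖ = ‖(1 + 2 * c) - (c - z)‖ := by congr 1; ring
      _ ≤ ‖1 + 2 * c‖ + ‖c - z‖ := norm_sub_le _ _
      _ ≤ _ := by nlinarith [norm_nonneg (1 + 2 * c)]
  have hpos : 0 < ‖c - z‖ := by linarith
  refine le_of_mul_le_mul_left ?_ hpos
  rw [e']
  calc _ ≤ (1 + ‖1 + 2 * c‖) * ‖c - z‖ * ‖invGammaPair c (z + 1)‖ := by gcongr
    _ = _ := by ring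

theorem norm_invGammaPair_le_add_natCast (c z : ℂ) (h : |c.im| + 1 ≤ |z.im|) (M : ℕ) :
    ‖invGammaPair c z‖ ≤ (1 + ‖1 + 2 * c‖) ^ M * ‖invGammaPair c (z + M)‖ := by
  induction M with
  | zero => simp
  | succ M ih =>
    refine ih.trans ?_
    rw [pow_succ, mul_assoc]
    gcongr
    have := norm_invGammaPair_le_add_one c (z + M) (by simpa using h)
    rwa [add_assoc, ← Nat.cast_succ] at this

/-- The growth of a function of exponential type `τ` with decay exponent `p` in the real direction,
up to a polynomial of degree `K` in the imaginary direction. -/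
noncomputable def expTypeWeight (τ p : ℝ) (K : ℕ) (z : ℂ) : ℝ :=
  (1 + |z.im|) ^ K * Real.exp (τ * |z.im|) * (1 + |z.re|) ^ (-p)

theorem expTypeWeight_pos (τ p : ℝ) (K : ℕ) (z : ℂ) : 0 < expTypeWeight τ p K z := by
  unfold expTypeWeight
  positivity

theorem exists_norm_invGammaPair_le_of_le_re (c : ℂ) :
    ∃ (C X : ℝ) (K : ℕ), 0 ≤ C ∧ 1 ≤ X ∧ ∀ z : ℂ, X ≤ z.re →
      ‖invGammaPair c z‖ ≤ C * expTypeWeight Real.pi (1 + 2 * c.re) K z := by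
  obtain ⟨C, X, K, hC, hX, h⟩ := exists_norm_Gamma_div_Gamma_le c
  refine ⟨Real.exp (Real.pi * |c.im|) / Real.pi * (C * 2 ^ |-(1 + 2 * c.re)|), max X (|c.re| + 1),
    K, by positivity, le_max_of_le_left hX, fun z hz => ?_⟩
  have hzX := (le_max_left _ _).trans hz
  have hzc := (le_max_right _ _).trans hz
  have hz0 : 0 < z.re := by linarith
  have hs : ‖Complex.sin (Real.pi * (z - c))‖
      ≤ Real.exp (Real.pi * |c.im|) * Real.exp (Real.pi * |z.im|) := by
    refine (norm_complex_sin_le _).trans ?_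
    rw [← Real.exp_add, Real.exp_le_exp, im_ofReal_mul, abs_mul, abs_of_pos Real.pi_pos,
      ← mul_add, sub_im]
    gcongr
    rw [add_comm]
    exact abs_sub _ _
  have hq : z.re ^ (-(1 + 2 * c.re)) ≤
      2 ^ |-(1 + 2 * c.re)| * (1 + |z.re|) ^ (-(1 + 2 * c.re)) := by
    refine rpow_le_rpow_abs_mul_of_comparable hz0 (by positivity) ?_ ?_ _ <;>
      rw [abs_of_pos hz0] <;> linarith
  rw [invGammaPair_eq_sin_mul c z (by linarith [le_abs_self c.re]), norm_mul, norm_div, norm_real,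
    Real.norm_of_nonneg Real.pi_pos.le, expTypeWeight]
  calc _ ≤ Real.exp (Real.pi * |c.im|) * Real.exp (Real.pi * |z.im|) / Real.pi *
        (C * (1 + |z.im|) ^ K * (2 ^ |-(1 + 2 * c.re)| * (1 + |z.re|) ^ (-(1 + 2 * c.re)))) := by
          gcongr
          exact (h z hzX).trans (by gcongr)
    _ = _ := by ring

/-- Three regions: |Re z| ≥ X follows from the right half-plane by evenness; |Re z| < X with large
|Im z| follows by translating to the right by M; the remaining rectangle is compact. -/
theorem exists_norm_invGammaPair_le (c : ℂ) :
    ∃ (C : ℝ) (K : ℕ), 0 ≤ C ∧ ∀ z : ℂ,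
      ‖invGammaPair c z‖ ≤ C * expTypeWeight Real.pi (1 + 2 * c.re) K z := by
  obtain ⟨C, X, K, hC, hX, h⟩ := exists_norm_invGammaPair_le_of_le_re c
  -- With M > 2X, translation by M sends |Re z| < X into Re z ≥ X.
  obtain ⟨M, hM⟩ := exists_nat_gt (2 * X)
  set q : ℝ := -(1 + 2 * c.re) with hq
  set A : ℝ := (1 + ‖1 + 2 * c‖) ^ M * (C * (1 + (M : ℝ)) ^ |q|) with hA
  have hA0 : 0 ≤ A := by positivity
  have hbounded : ∃ B : ℝ, 0 ≤ B ∧ ∀ z : ℂ, |z.re| ≤ X → |z.im| ≤ |c.im| + 1 →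
      ‖invGammaPair c z‖ ≤ B := by
    have hK : IsCompact (Set.Icc (-X) X ×ℂ Set.Icc (-(|c.im| + 1)) (|c.im| + 1)) :=
      isCompact_Icc.reProdIm isCompact_Icc
    obtain ⟨B, hB⟩ := hK.exists_bound_of_continuousOn
      (differentiable_invGammaPair c).continuous.continuousOn
    exact ⟨max B 0, le_max_right _ _, fun z h1 h2 =>
      (hB z ⟨abs_le.1 h1, abs_le.1 h2⟩).trans (le_max_left _ _)⟩
  obtain ⟨B, hB0, hB⟩ := hbounded
  refine ⟨C + A + B * (1 + X) ^ |q|, K, by positivity, fun z => ?_⟩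
  have hw := (expTypeWeight_pos Real.pi (1 + 2 * c.re) K z).le
  have hmono : ∀ D : ℝ, D ≤ C + A + B * (1 + X) ^ |q| →
      ‖invGammaPair c z‖ ≤ D * expTypeWeight Real.pi (1 + 2 * c.re) K z →
      ‖invGammaPair c z‖ ≤
        (C + A + B * (1 + X) ^ |q|) * expTypeWeight Real.pi (1 + 2 * c.re) K z :=
    fun D h1 h2 => h2.trans (mul_le_mul_of_nonneg_right h1 hw)
  have hBX : 0 ≤ B * (1 + X) ^ |q| := by positivity
  rcases le_or_gt X |z.re| with hre | hre
  · refine hmono C (by linarith) ?_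
    rcases le_abs.1 hre with h1 | h1
    · exact h z h1
    · have := h (-z) (by simpa using h1)
      simpa [invGammaPair_neg, expTypeWeight] using this
  rcases le_or_gt (|c.im| + 1) |z.im| with him | him
  · refine hmono A (by linarith) ?_
    have hre' := abs_lt.1 hre
    have hzM : X ≤ (z + M).re := by simp; linarith
    refine (norm_invGammaPair_le_add_natCast c z him M).trans ?_
    have hb := h (z + M) hzM
    have habs : |(z + M).re| = z.re + M := by
      rw [abs_of_nonneg (by linarith)]; simp
    have hcmp : (1 + |(z + M).re|) ^ q ≤ (1 + (M : ℝ)) ^ |q| * (1 + |z.re|) ^ q := by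
      rw [habs]
      have h0 := abs_nonneg z.re
      have hp : 0 ≤ (M : ℝ) * |z.re| := by positivity
      refine rpow_le_rpow_abs_mul_of_comparable (by linarith) (by positivity) ?_ ?_ q
      · linarith [le_abs_self z.re]
      · nlinarith
    rw [hA, mul_assoc]
    gcongr
    refine hb.trans ?_
    unfold expTypeWeight
    rw [← hq]
    have him2 : (z + M).im = z.im := by simp
    rw [him2]
    calc _ ≤ C * ((1 + |z.im|) ^ K * Real.exp (Real.pi * |z.im|) *
          ((1 + (M : ℝ)) ^ |q| * (1 + |z.re|) ^ q)) := by gcongr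
      _ = _ := by ring
  · refine hmono (B * (1 + X) ^ |q|) (by linarith) ?_
    refine (hB z hre.le him.le).trans ?_
    have h0 := abs_nonneg z.re
    have h1 : (1 : ℝ) ^ q ≤ (1 + X) ^ |q| * (1 + |z.re|) ^ q :=
      rpow_le_rpow_abs_mul_of_comparable one_pos (by positivity) (by nlinarith) (by nlinarith) q
    rw [Real.one_rpow] at h1
    have h2 : (1 : ℝ) ≤ (1 + |z.im|) ^ K * Real.exp (Real.pi * |z.im|) :=
      one_le_mul_of_one_le_of_one_le (one_le_pow₀ (by linarith [abs_nonneg z.im]))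
        (Real.one_le_exp (by positivity))
    unfold expTypeWeight
    rw [← hq]
    calc B = B * (1 * 1) := by ring
      _ ≤ B * (((1 + |z.im|) ^ K * Real.exp (Real.pi * |z.im|)) *
          ((1 + X) ^ |q| * (1 + |z.re|) ^ q)) := by gcongr
      _ = _ := by ring

end InvGammaPair

/-! ### Moving a horizontal line of integration -/

section ContourShift

open Complex MeasureTheory Filter Topology

theorem integrable_horizontal_of_norm_le {h : ℂ → ℂ} (hd : Differentiable ℂ h) {s C T : ℝ}
    (hs : 1 < s) (hb : ∀ z : ℂ, z.im = T → ‖h z‖ ≤ C * (1 + |z.re|) ^ (-s)) :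
    Integrable (fun x : ℝ => h (x + T * I)) := by
  have hi : Integrable (fun x : ℝ => (1 + ‖x‖) ^ (-s)) :=
    integrable_one_add_norm (by simpa using hs)
  refine (hi.const_mul C).mono' ?_ (Eventually.of_forall fun x => ?_)
  · have : Continuous fun x : ℝ => h (x + T * I) := hd.continuous.comp (by fun_prop)
    exact this.aestronglyMeasurable
  · simpa using hb (x + T * I) (by simp)

/-- Cauchy's theorem on the rectangle between -R and R + iT; the vertical sides are O((1 + R)^(-s)).
-/
theorem integral_horizontal_eq {h : ℂ → ℂ} (hd : Differentiable ℂ h) {s C T : ℝ} (hs : 1 < s)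
    (hb : ∀ z : ℂ, |z.im| ≤ |T| → ‖h z‖ ≤ C * (1 + |z.re|) ^ (-s)) :
    ∫ x : ℝ, h (x + T * I) = ∫ x : ℝ, h x := by
  have i0 : Integrable (fun x : ℝ => h x) := by
    simpa using integrable_horizontal_of_norm_le (T := 0) hd hs fun z hz => hb z (by simp [hz])
  have iT := integrable_horizontal_of_norm_le (T := T) hd hs fun z hz => hb z (by rw [hz])
  have hrect : ∀ R : ℝ, (∫ x in -R..R, h x) - (∫ x in -R..R, h (x + T * I)) +
      I • (∫ y in (0 : ℝ)..T, h (R + y * I)) - I • (∫ y in (0 : ℝ)..T, h (-R + y * I)) = 0 := by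
    intro R
    simpa using integral_boundary_rect_eq_zero_of_differentiableOn h (-R : ℂ) (R + T * I)
      hd.differentiableOn
  have hside : ∀ ε : ℝ, |ε| = 1 →
      Tendsto (fun R : ℝ => ∫ y in (0 : ℝ)..T, h ((ε * R : ℝ) + y * I)) atTop (𝓝 0) := by
    intro ε hε
    have hlim : Tendsto (fun R : ℝ => C * (1 + R) ^ (-s) * |T - 0|) atTop (𝓝 0) := by
      have h1 : Tendsto (fun R : ℝ => (1 + R) ^ (-s)) atTop (𝓝 0) :=
        (tendsto_rpow_neg_atTop (by linarith)).comp (tendsto_atTop_add_const_left _ _ tendsto_id)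
      simpa using (h1.const_mul C).mul_const |T - 0|
    refine squeeze_zero_norm' ?_ hlim
    filter_upwards [eventually_ge_atTop 0] with R hR
    refine intervalIntegral.norm_integral_le_of_norm_le_const fun y hy => ?_
    have hy' : |y| ≤ |T| := by
      rcases Set.mem_uIoc.1 hy with ⟨h1, h2⟩ | ⟨h1, h2⟩
      · rw [abs_of_pos h1, abs_of_pos (h1.trans_le h2)]; exact h2
      · rw [abs_of_nonpos h2, abs_of_neg (h1.trans_le h2)]; linarith
    have := hb ((ε * R : ℝ) + y * I) (by simpa using hy')
    simpa [abs_mul, hε, abs_of_nonneg hR] using this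
  have hp := hside 1 (by simp)
  have hm := hside (-1) (by simp)
  have t0 := intervalIntegral_tendsto_integral i0 tendsto_neg_atTop_atBot tendsto_id
  have tT := intervalIntegral_tendsto_integral iT tendsto_neg_atTop_atBot tendsto_id
  have hlim := ((t0.sub tT).add (hp.const_smul I)).sub (hm.const_smul I)
  have hzero : (fun R : ℝ => (∫ x in -R..id R, h x) - (∫ x in -R..id R, h (x + T * I)) +
      I • (∫ y in (0 : ℝ)..T, h ((1 * R : ℝ) + y * I)) -
      I • (∫ y in (0 : ℝ)..T, h ((-1 * R : ℝ) + y * I))) = fun _ => 0 := by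
    ext R
    simpa using hrect R
  rw [hzero] at hlim
  have := tendsto_nhds_unique hlim tendsto_const_nhds
  simp only [smul_zero, add_zero, sub_zero] at this
  exact (sub_eq_zero.1 this).symm

end ContourShift

/-! ### Vanishing of Fourier coefficients and Poisson summation -/

section PaleyWiener

open Complex MeasureTheory Filter Topology
open scoped FourierTransform

variable {F : ℂ → ℂ} {τ s C : ℝ} {K : ℕ}

theorem expTypeWeight_le_of_abs_im_le {τ : ℝ} (hτ : 0 ≤ τ) (s : ℝ) (K : ℕ) {T : ℝ} {z : ℂ}
    (hz : |z.im| ≤ T) :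
    expTypeWeight τ s K z ≤ (1 + T) ^ K * Real.exp (τ * T) * (1 + |z.re|) ^ (-s) := by
  unfold expTypeWeight
  have := abs_nonneg z.im
  have hT : 0 ≤ T := this.trans hz
  gcongr

theorem integrable_ofReal_of_le_expTypeWeight (hd : Differentiable ℂ F) (hs : 1 < s)
    (hF : ∀ z, ‖F z‖ ≤ C * expTypeWeight τ s K z) : Integrable (fun x : ℝ => F x) := by
  have := integrable_horizontal_of_norm_le (C := C) (T := 0) hd hs fun z hz => by
    simpa [expTypeWeight, hz] using hF z
  simpa using this

/-- Shifting the line by t in the direction where exp(-2πiξz) decays bounds the transform by a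
constant times (1 + t)^K exp(-(2π|ξ| - τ)t), which tends to 0. -/
theorem fourier_eq_zero_of_expType_lt (hd : Differentiable ℂ F) (hτ : 0 ≤ τ) (hs : 1 < s)
    (hC : 0 ≤ C) (hF : ∀ z, ‖F z‖ ≤ C * expTypeWeight τ s K z) {ξ : ℝ}
    (hξ : τ < 2 * Real.pi * |ξ|) : 𝓕 (fun x : ℝ => F x) ξ = 0 := by
  set a : ℝ := 2 * Real.pi * |ξ| - τ with ha
  have ha0 : 0 < a := by linarith
  set h : ℂ → ℂ := fun z => Complex.exp (-(2 * Real.pi * ξ) * I * z) * F z with hh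
  have hhd : Differentiable ℂ h := by
    have : Differentiable ℂ fun z : ℂ => Complex.exp (-(2 * Real.pi * ξ) * I * z) := by fun_prop
    exact this.mul hd
  have hnorm : ∀ z, ‖h z‖ = Real.exp (2 * Real.pi * ξ * z.im) * ‖F z‖ := by
    intro z
    rw [hh, norm_mul, Complex.norm_exp]
    congr 2
    simp
  have hfour : 𝓕 (fun x : ℝ => F x) ξ = ∫ x : ℝ, h x := by
    rw [Real.fourier_real_eq_integral_exp_smul]
    refine integral_congr_ae (Eventually.of_forall fun x => ?_)
    simp only [hh, smul_eq_mul]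
    congr 2
    push_cast
    ring
  obtain ⟨ε, hε, hεξ⟩ : ∃ ε : ℝ, |ε| = 1 ∧ ξ * ε = -|ξ| := by
    rcases le_total 0 ξ with h0 | h0
    · exact ⟨-1, by simp, by rw [abs_of_nonneg h0]; ring⟩
    · exact ⟨1, by simp, by rw [abs_of_nonpos h0]; ring⟩
  have hi : Integrable (fun x : ℝ => (1 + ‖x‖) ^ (-s)) :=
    integrable_one_add_norm (by simpa using hs)
  set J : ℝ := ∫ x : ℝ, (1 + ‖x‖) ^ (-s) with hJ
  -- The factor exp a lets the decay be written in 1 + t alone, so that the limit is that of a power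
  -- over an exponential.
  have hbound : ∀ t : ℝ, 0 ≤ t →
      ‖∫ x : ℝ, h x‖ ≤ C * J * Real.exp a * ((1 + t) ^ K / Real.exp (a * (1 + t))) := by
    intro t ht
    have habs : |ε * t| = t := by rw [abs_mul, hε, one_mul, abs_of_nonneg ht]
    have hshift : ∫ x : ℝ, h (x + (ε * t : ℝ) * I) = ∫ x : ℝ, h x := by
      refine integral_horizontal_eq (s := s)
        (C := Real.exp (2 * Real.pi * |ξ| * t) * (C * ((1 + t) ^ K * Real.exp (τ * t))))
        hhd hs fun z hz => ?_
      rw [habs] at hz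
      have h1 : ξ * z.im ≤ |ξ| * t := by
        refine (le_abs_self _).trans ?_
        rw [abs_mul]
        gcongr
      have h2 : 2 * Real.pi * ξ * z.im ≤ 2 * Real.pi * |ξ| * t := by
        rw [mul_assoc, mul_assoc _ |ξ|]
        gcongr
      rw [hnorm]
      calc Real.exp (2 * Real.pi * ξ * z.im) * ‖F z‖
          ≤ Real.exp (2 * Real.pi * |ξ| * t) *
            (C * ((1 + t) ^ K * Real.exp (τ * t) * (1 + |z.re|) ^ (-s))) := by
              gcongr
              exact (hF z).trans (by gcongr; exact expTypeWeight_le_of_abs_im_le hτ s K hz)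
        _ = _ := by ring
    rw [← hshift]
    calc ‖∫ x : ℝ, h (x + (ε * t : ℝ) * I)‖
        ≤ ∫ x : ℝ, (C * Real.exp a * ((1 + t) ^ K / Real.exp (a * (1 + t)))) *
            (1 + ‖x‖) ^ (-s) := by
          refine norm_integral_le_of_norm_le (hi.const_mul _) (Eventually.of_forall fun x => ?_)
          have him : ((x : ℂ) + (ε * t : ℝ) * I).im = ε * t := by simp
          have hre : ((x : ℂ) + (ε * t : ℝ) * I).re = x := by simp
          have h2 := hF ((x : ℂ) + (ε * t : ℝ) * I)
          rw [expTypeWeight, him, hre, habs] at h2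
          rw [hnorm, him]
          have h3 : 2 * Real.pi * ξ * (ε * t) = -(2 * Real.pi * |ξ| * t) := by
            linear_combination 2 * Real.pi * t * hεξ
          rw [h3]
          have h4 : Real.exp (-(2 * Real.pi * |ξ| * t)) * Real.exp (τ * t)
              = Real.exp a / Real.exp (a * (1 + t)) := by
            rw [← Real.exp_add, ← Real.exp_sub]
            congr 1
            rw [ha]
            ring
          calc _ ≤ Real.exp (-(2 * Real.pi * |ξ| * t)) *
                (C * ((1 + t) ^ K * Real.exp (τ * t) * (1 + |x|) ^ (-s))) := by gcongr
            _ = C * ((1 + t) ^ K * (Real.exp (-(2 * Real.pi * |ξ| * t)) * Real.exp (τ * t))) *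
                (1 + |x|) ^ (-s) := by ring
            _ = _ := by rw [h4, Real.norm_eq_abs]; ring
      _ = _ := by rw [integral_const_mul, ← hJ]; ring
  have hlim : Tendsto (fun t : ℝ => C * J * Real.exp a * ((1 + t) ^ K / Real.exp (a * (1 + t))))
      atTop (𝓝 0) := by
    have h1 := (isLittleO_pow_exp_pos_mul_atTop K ha0).tendsto_div_nhds_zero.comp
      (tendsto_atTop_add_const_left atTop (1 : ℝ) tendsto_id)
    simpa using h1.const_mul (C * J * Real.exp a)
  have hle : ‖∫ x : ℝ, h x‖ ≤ 0 :=
    ge_of_tendsto hlim ((eventually_ge_atTop 0).mono hbound)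
  rw [hfour]
  exact norm_le_zero_iff.1 hle

theorem continuous_fourier_real {f : ℝ → ℂ} (hf : Integrable f) : Continuous (𝓕 f) :=
  VectorFourier.fourierIntegral_continuous Real.continuous_fourierChar
    (innerSL ℝ).continuous₂ hf

/-- Continuity of the transform, approaching ξ through rξ with r ↓ 1. The boundary case is essential
for m = 4, where the frequencies ±2 satisfy 2π|ξ| = 4π = τ. -/
theorem fourier_eq_zero_of_expType_le (hd : Differentiable ℂ F) (hτ : 0 ≤ τ) (hs : 1 < s)
    (hC : 0 ≤ C) (hF : ∀ z, ‖F z‖ ≤ C * expTypeWeight τ s K z) {ξ : ℝ} (hξ0 : ξ ≠ 0)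
    (hξ : τ ≤ 2 * Real.pi * |ξ|) : 𝓕 (fun x : ℝ => F x) ξ = 0 := by
  have hcont := continuous_fourier_real (integrable_ofReal_of_le_expTypeWeight hd hs hF)
  have h1 : Tendsto (fun r : ℝ => 𝓕 (fun x : ℝ => F x) (r * ξ)) (𝓝[>] 1)
      (𝓝 (𝓕 (fun x : ℝ => F x) (1 * ξ))) :=
    ((hcont.comp (continuous_id.mul continuous_const)).tendsto 1).mono_left nhdsWithin_le_nhds
  have h2 : (fun r : ℝ => 𝓕 (fun x : ℝ => F x) (r * ξ)) =ᶠ[𝓝[>] 1] fun _ => 0 := by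
    filter_upwards [self_mem_nhdsWithin] with r hr
    have hr1 : 1 < r := hr
    refine fourier_eq_zero_of_expType_lt hd hτ hs hC hF (hξ.trans_lt ?_)
    rw [abs_mul, abs_of_pos (zero_lt_one.trans hr1)]
    have : 0 < 2 * Real.pi * |ξ| := by positivity
    nlinarith
  rw [one_mul] at h1
  exact tendsto_nhds_unique h1 (tendsto_const_nhds.congr' h2.symm)

theorem isBigO_cocompact_of_le_expTypeWeight (hs : 0 ≤ s) (hC : 0 ≤ C)
    (hF : ∀ z, ‖F z‖ ≤ C * expTypeWeight τ s K z) :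
    (fun x : ℝ => F x) =O[cocompact ℝ] fun x : ℝ => |x| ^ (-s) := by
  refine Asymptotics.IsBigO.of_bound C ?_
  filter_upwards [(isCompact_singleton (x := (0 : ℝ))).compl_mem_cocompact] with x hx
  have hx0 : 0 < |x| := abs_pos.2 hx
  refine (hF x).trans ?_
  rw [Real.norm_of_nonneg (by positivity)]
  gcongr
  simpa [expTypeWeight] using
    Real.rpow_le_rpow_of_nonpos hx0 (by linarith : |x| ≤ 1 + |x|) (by linarith : -s ≤ 0)

/-- An even entire function of exponential type at most `4π` that is integrable on the real line is
integrated exactly by its sum over `1/4 + ℤ`. -/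
theorem tsum_quarter_add_int_eq_integral (hd : Differentiable ℂ F) (heven : ∀ z, F (-z) = F z)
    (hτ : 0 ≤ τ) (hτ4 : τ ≤ 4 * Real.pi) (hs : 1 < s) (hC : 0 ≤ C)
    (hF : ∀ z, ‖F z‖ ≤ C * expTypeWeight τ s K z) :
    ∑' n : ℤ, F (1 / 4 + n) = ∫ x : ℝ, F x := by
  set f : ℝ → ℂ := fun x => F x with hf
  have hc : Continuous f := hd.continuous.comp continuous_ofReal
  have hvan : ∀ n : ℤ, n ∉ ({0, 1, -1} : Finset ℤ) → 𝓕 f n = 0 := by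
    intro n hn
    simp only [Finset.mem_insert, Finset.mem_singleton, not_or] at hn
    obtain ⟨n0, n1, n2⟩ := hn
    have h2 : (2 : ℤ) ≤ |n| := by
      rcases abs_cases n with ⟨h, _⟩ | ⟨h, _⟩ <;> omega
    have h2r : (2 : ℝ) ≤ |(n : ℝ)| := by exact_mod_cast h2
    refine fourier_eq_zero_of_expType_le hd hτ hs hC hF (by exact_mod_cast n0) (hτ4.trans ?_)
    nlinarith [Real.pi_pos]
  have hP := Real.tsum_eq_tsum_fourier_of_rpow_decay_of_summable hc hs
    (isBigO_cocompact_of_le_expTypeWeight (by linarith) hC hF)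
    (summable_of_ne_finset_zero hvan) (1 / 4)
  have hS : ∑' n : ℤ, 𝓕 f n * fourier n ((1 / 4 : ℝ) : UnitAddCircle) =
      ∑ n ∈ ({0, 1, -1} : Finset ℤ), 𝓕 f n * fourier n ((1 / 4 : ℝ) : UnitAddCircle) :=
    tsum_eq_sum fun n hn => by rw [hvan n hn, zero_mul]
  rw [hS] at hP
  -- Evenness is used here; the characters of ±1 at 1/4 are i and -i, so the two terms cancel.
  have hsymm : 𝓕 f (-1) = 𝓕 f 1 := by
    rw [Real.fourier_real_eq_integral_exp_smul, Real.fourier_real_eq_integral_exp_smul,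
      ← integral_neg_eq_self]
    refine integral_congr_ae (Eventually.of_forall fun x => ?_)
    simp [hf, heven]
  have hzero : 𝓕 f 0 = ∫ x : ℝ, F x := by
    rw [Real.fourier_real_eq_integral_exp_smul]
    simp [hf]
  have e1 : Complex.exp (2 * Real.pi * I * ((1 : ℤ) : ℂ) * ((1 / 4 : ℝ) : ℂ) / ((1 : ℝ) : ℂ))
      = I := by
    convert! Complex.exp_pi_div_two_mul_I using 2
    push_cast
    ring
  have e2 : Complex.exp (2 * Real.pi * I * ((-1 : ℤ) : ℂ) * ((1 / 4 : ℝ) : ℂ) / ((1 : ℝ) : ℂ))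
      = -I := by
    convert! Complex.exp_neg_pi_div_two_mul_I using 2
    push_cast
    ring
  rw [Finset.sum_insert (by decide), Finset.sum_insert (by decide), Finset.sum_singleton,
    fourier_coe_apply, fourier_coe_apply, fourier_coe_apply, e1, e2] at hP
  simp only [Int.cast_zero, Int.cast_one, Int.cast_neg, hsymm, hzero] at hP
  simp only [hf] at hP
  push_cast at hP
  rw [hP]
  simp [hf]

end PaleyWiener

/-! ### Shifted factorials and the values at 1/4 + n -/

section ShiftedFactorial

theorem shiftedFactorial_natCast (c : ℂ) (n : ℕ) :
    shiftedFactorial c (n : ℤ) = ∏ k ∈ range n, (c + (k : ℂ)) := rfl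

theorem shiftedFactorial_neg_natCast (c : ℂ) (n : ℕ) :
    shiftedFactorial c (-(n : ℤ)) = (∏ k ∈ range n, (c - ((k : ℂ) + 1)))⁻¹ := by
  cases n with
  | zero => simp [shiftedFactorial]
  | succ n => rfl

theorem shiftedFactorial_natCast_eq_reflect (c : ℂ) (n : ℕ) :
    shiftedFactorial c (n : ℤ) = (-1) ^ n * (shiftedFactorial (1 - c) (-(n : ℤ)))⁻¹ := by
  rw [shiftedFactorial_natCast, shiftedFactorial_neg_natCast, inv_inv]
  nth_rewrite 2 [← card_range n]
  rw [← prod_const, ← prod_mul_distrib]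
  refine prod_congr rfl fun k _ => ?_
  ring

/-- No condition on c is needed: both sides are the same finite product or its inverse, with 0⁻¹ =
0. -/
theorem shiftedFactorial_eq_reflect (c : ℂ) (n : ℤ) :
    shiftedFactorial c n = (-1) ^ n * (shiftedFactorial (1 - c) (-n))⁻¹ := by
  obtain ⟨k, rfl | rfl⟩ := n.eq_nat_or_neg
  · simpa using shiftedFactorial_natCast_eq_reflect c k
  · have h := shiftedFactorial_natCast_eq_reflect (1 - c) k
    rw [sub_sub_cancel] at h
    have hsq : ((-1 : ℂ) ^ k) * (-1) ^ k = 1 := by rw [← mul_pow]; simp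
    rw [neg_neg, h, mul_inv, inv_inv, zpow_neg, zpow_natCast, ← mul_assoc, ← mul_inv, hsq,
      inv_one, one_mul]

theorem inv_Gamma_add_intCast (b : ℂ) (hb : ∀ k : ℕ, b ≠ -(k : ℂ)) (n : ℤ) :
    (Complex.Gamma (b + n))⁻¹ = (Complex.Gamma b)⁻¹ * (shiftedFactorial b n)⁻¹ := by
  obtain ⟨k, rfl | rfl⟩ := n.eq_nat_or_neg
  · rw [shiftedFactorial_natCast, Int.cast_natCast, Gamma_add_natCast_eq_prod b k hb, mul_inv,
      mul_comm]
  · rw [shiftedFactorial_neg_natCast, inv_inv]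
    push_cast
    induction k with
    | zero => simp
    | succ k ih =>
      rw [prod_range_succ, ← mul_assoc, ← ih,
        Complex.one_div_Gamma_eq_self_mul_one_div_Gamma_add_one]
      push_cast
      rw [show b + -((k : ℂ) + 1) + 1 = b + -(k : ℂ) by ring]
      ring

theorem shiftedFactorial_neg_natCast_base_eq_zero {k n : ℕ} (h : k < n) :
    shiftedFactorial (-(k : ℂ)) (n : ℤ) = 0 := by
  rw [shiftedFactorial_natCast]
  exact prod_eq_zero (mem_range.2 h) (by simp)

/-- Reflecting the upper factor produces a sign (-1)^n that cancels the one in the statement. One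
such sign per factor is why the series has argument (-1)^m. -/
theorem shiftedFactorial_div_mul_eq_invGammaPair (c : ℂ) (hb : ∀ k : ℕ, 5 / 4 + c ≠ -(k : ℂ))
    (ha : ∀ k : ℕ, 1 ≤ k → 1 / 4 - c ≠ (k : ℂ)) (n : ℤ) :
    (Complex.Gamma (c + 5 / 4) * Complex.Gamma (c + 3 / 4))⁻¹ *
      (shiftedFactorial (1 / 4 - c) n / shiftedFactorial (5 / 4 + c) n * (-1) ^ n)
      = invGammaPair c (1 / 4 + n) := by
  have ha' : ∀ k : ℕ, 3 / 4 + c ≠ -(k : ℂ) := fun k hk => ha (k + 1) (by omega) (by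
    push_cast; linear_combination -hk)
  have h1 := inv_Gamma_add_intCast _ hb n
  have h2 := inv_Gamma_add_intCast _ ha' (-n)
  have h3 := shiftedFactorial_eq_reflect (1 / 4 - c) n
  rw [show 1 - (1 / 4 - c) = 3 / 4 + c by ring] at h3
  have hsq : ((-1 : ℂ) ^ n) * (-1) ^ n = 1 := by rw [← mul_zpow]; simp
  push_cast at h2
  rw [invGammaPair, mul_inv, mul_inv, show 1 + c + (1 / 4 + (n : ℂ)) = 5 / 4 + c + n by ring,
    show 1 + c - (1 / 4 + (n : ℂ)) = 3 / 4 + c + -n by ring, h1, h2, h3,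
    add_comm c, add_comm c]
  generalize Complex.Gamma (5 / 4 + c) = A
  generalize Complex.Gamma (3 / 4 + c) = B
  generalize shiftedFactorial (5 / 4 + c) n = S
  generalize shiftedFactorial (3 / 4 + c) (-n) = T
  linear_combination A⁻¹ * B⁻¹ * T⁻¹ * S⁻¹ * hsq

theorem bilateralTerm_neg_one_pow {m : ℕ} (a b : Fin m → ℂ) (n : ℤ) :
    bilateralTerm a b ((-1) ^ m) n
      = ∏ j, (shiftedFactorial (a j) n / shiftedFactorial (b j) n * (-1) ^ n) := by
  rw [bilateralTerm, prod_mul_distrib, prod_div_distrib, prod_const, card_univ, Fintype.card_fin,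
    ← zpow_natCast, ← zpow_natCast, ← zpow_mul, ← zpow_mul, mul_comm (m : ℤ)]

end ShiftedFactorial

/-! ### Absolute convergence of the bilateral series -/

section Summability

open Filter

variable {m : ℕ}

theorem exists_norm_shiftedFactorial_div_le (x : ℝ) (c : ℂ) (h1 : ∀ k : ℕ, x - c ≠ -(k : ℂ))
    (h2 : ∀ k : ℕ, x + 1 + c ≠ -(k : ℂ)) :
    ∃ C : ℝ, 0 ≤ C ∧ ∀ᶠ n : ℕ in atTop,
      ‖shiftedFactorial (x - c) (n : ℤ) / shiftedFactorial (x + 1 + c) (n : ℤ)‖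
        ≤ C * (x + n) ^ (-(1 + 2 * c.re)) := by
  obtain ⟨C, X, K, hC, -, h⟩ := exists_norm_Gamma_div_Gamma_le c
  refine ⟨‖Complex.Gamma (x + 1 + c) / Complex.Gamma (x - c)‖ * C, by positivity, ?_⟩
  filter_upwards [eventually_ge_atTop ⌈X - x⌉₊] with n hn
  have hn' : X ≤ ((x : ℂ) + n).re := by
    have := Nat.ceil_le.1 hn
    simp; linarith
  have hb := h _ hn'
  have g1 := Complex.Gamma_ne_zero h1
  have g2 := Complex.Gamma_ne_zero h2
  have e1 := Gamma_add_natCast_eq_prod _ n h1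
  have e2 := Gamma_add_natCast_eq_prod _ n h2
  rw [show (x : ℂ) + n - c = x - c + n by ring, show (x : ℂ) + n + 1 + c = x + 1 + c + n by ring,
    e1, e2] at hb
  have e : shiftedFactorial (x - c) (n : ℤ) / shiftedFactorial (x + 1 + c) (n : ℤ)
      = Complex.Gamma (x + 1 + c) / Complex.Gamma (x - c) *
        ((∏ k ∈ range n, ((x : ℂ) - c + k)) * Complex.Gamma (x - c) /
          ((∏ k ∈ range n, ((x : ℂ) + 1 + c + k)) * Complex.Gamma (x + 1 + c))) := by
    rw [shiftedFactorial_natCast, shiftedFactorial_natCast, mul_div_mul_comm]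
    field_simp
  rw [e, norm_mul, mul_assoc]
  gcongr
  simpa using hb

theorem summable_prod_shiftedFactorial_div (x : ℝ) (c : Fin m → ℂ)
    (hc : 1 < m + 2 * (∑ j, c j).re) :
    Summable fun n : ℕ =>
      ∏ j, (shiftedFactorial (x - c j) (n : ℤ) / shiftedFactorial (x + 1 + c j) (n : ℤ)) := by
  -- In the degenerate case some factor is eventually 0, by a vanishing numerator or by division by
  -- zero, so the sum is finite.
  by_cases hdeg : ∃ j, ∃ k : ℕ, x - c j = -(k : ℂ) ∨ x + 1 + c j = -(k : ℂ)
  · obtain ⟨j, k, hjk⟩ := hdeg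
    refine summable_of_ne_finset_zero (s := range (k + 1)) fun n hn => ?_
    have hkn : k < n := by simpa using hn
    refine prod_eq_zero (mem_univ j) ?_
    rcases hjk with h | h
    · rw [h, shiftedFactorial_neg_natCast_base_eq_zero hkn, zero_div]
    · rw [h, shiftedFactorial_neg_natCast_base_eq_zero hkn, div_zero]
  · push Not at hdeg
    choose C hC h using fun j => exists_norm_shiftedFactorial_div_le x (c j)
      (fun k => (hdeg j k).1) (fun k => (hdeg j k).2)
    set p : ℝ := m + 2 * (∑ j, c j).re with hp
    have hpsum : ∑ j, -(1 + 2 * (c j).re) = -p := by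
      rw [hp, sum_neg_distrib, sum_add_distrib, ← mul_sum, Complex.re_sum]
      simp
    refine summable_of_isBigO_nat (g := fun n : ℕ => (n : ℝ) ^ (-p))
      (Real.summable_nat_rpow.2 (by linarith)) ?_
    refine Asymptotics.IsBigO.of_bound ((∏ j, C j) * 2 ^ |-p|) ?_
    filter_upwards [eventually_all.2 h, eventually_ge_atTop (⌈2 * |x| + 1⌉₊)] with n hn hnx
    have hnx' : 2 * |x| + 1 ≤ n := Nat.ceil_le.1 hnx
    have hx := abs_le.1 (le_refl |x|)
    have hxn : 0 < x + n := by linarith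
    rw [norm_prod, Real.norm_of_nonneg (by positivity)]
    calc ∏ j, ‖shiftedFactorial (x - c j) (n : ℤ) / shiftedFactorial (x + 1 + c j) (n : ℤ)‖
        ≤ ∏ j, (C j * (x + n) ^ (-(1 + 2 * (c j).re))) :=
          prod_le_prod (fun _ _ => norm_nonneg _) fun j _ => hn j
      _ = (∏ j, C j) * (x + n) ^ (-p) := by
          rw [prod_mul_distrib, ← Real.rpow_sum_of_pos hxn, hpsum]
      _ ≤ (∏ j, C j) * (2 ^ |-p| * (n : ℝ) ^ (-p)) := by
          have := prod_nonneg fun j (_ : j ∈ univ) => hC j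
          gcongr
          exact rpow_le_rpow_abs_mul_of_comparable hxn (by linarith [abs_nonneg x]) (by linarith)
            (by linarith) _
      _ = _ := by ring

theorem summable_bilateralTerm (c : Fin m → ℂ) (hc : 1 < m + 2 * (∑ j, c j).re) :
    Summable (bilateralTerm (fun j => 1 / 4 - c j) (fun j => 5 / 4 + c j) ((-1) ^ m)) := by
  have hnorm : ∀ n : ℤ, ‖bilateralTerm (fun j => 1 / 4 - c j) (fun j => 5 / 4 + c j) ((-1) ^ m) n‖
      = ‖∏ j, (shiftedFactorial (1 / 4 - c j) n / shiftedFactorial (5 / 4 + c j) n)‖ := by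
    intro n
    rw [bilateralTerm, norm_mul, norm_zpow, norm_pow, norm_neg, norm_one, one_pow, one_zpow,
      mul_one, prod_div_distrib]
  have h1 := summable_prod_shiftedFactorial_div (1 / 4) c hc
  -- Reflection n ↦ -n turns 1/4 - c and 5/4 + c into 3/4 + c and -1/4 - c, which is the case x =
  -- -1/4.
  have h2 := summable_prod_shiftedFactorial_div (-1 / 4) c hc
  refine Summable.of_norm ?_
  simp only [hnorm]
  refine Summable.of_nat_of_neg ?_ ?_
  · refine h1.norm.congr fun n => ?_
    congr 1
    refine prod_congr rfl fun j _ => ?_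
    push_cast
    congr 2
    ring
  · refine h2.norm.congr fun n => ?_
    rw [norm_prod, norm_prod]
    refine prod_congr rfl fun j _ => ?_
    rw [shiftedFactorial_eq_reflect (1 / 4 - c j), shiftedFactorial_eq_reflect (5 / 4 + c j)]
    simp only [neg_neg, norm_div, norm_mul, norm_zpow, norm_neg, norm_one, one_zpow, one_mul,
      norm_inv, div_inv_eq_mul]
    rw [mul_comm, ← div_eq_mul_inv]
    push_cast
    congr 3 <;> ring

end Summability

/-! ### The integral as a bilateral series -/

section BilateralIntegral

variable {m : ℕ}

theorem exists_norm_prod_invGammaPair_le (c : Fin m → ℂ) :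
    ∃ (C : ℝ) (K : ℕ), 0 ≤ C ∧ ∀ z : ℂ, ‖∏ j, invGammaPair (c j) z‖
      ≤ C * expTypeWeight (m * Real.pi) (m + 2 * (∑ j, c j).re) K z := by
  choose C K hC h using fun j => exists_norm_invGammaPair_le (c j)
  refine ⟨∏ j, C j, ∑ j, K j, prod_nonneg fun j _ => hC j, fun z => ?_⟩
  have hpsum : ∑ j, -(1 + 2 * (c j).re) = -(m + 2 * (∑ j, c j).re) := by
    rw [sum_neg_distrib, sum_add_distrib, ← mul_sum, Complex.re_sum]
    simp
  have hw : ∏ j, expTypeWeight Real.pi (1 + 2 * (c j).re) (K j) z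
      = expTypeWeight (m * Real.pi) (m + 2 * (∑ j, c j).re) (∑ j, K j) z := by
    simp only [expTypeWeight]
    rw [prod_mul_distrib, prod_mul_distrib, prod_pow_eq_pow_sum, ← Real.exp_sum,
      ← Real.rpow_sum_of_pos (by positivity), hpsum]
    simp [mul_assoc]
  rw [norm_prod, ← hw, ← prod_mul_distrib]
  exact prod_le_prod (fun _ _ => norm_nonneg _) fun j _ => h j z

theorem differentiable_prod_invGammaPair (c : Fin m → ℂ) :
    Differentiable ℂ fun z => ∏ j, invGammaPair (c j) z :=
  Differentiable.fun_finsetProd fun j _ => differentiable_invGammaPair (c j)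

theorem invGammaPair_quarter_eq_zero_of_le {c : ℂ} {k : ℕ} (hc : 5 / 4 + c = -(k : ℂ)) {n : ℤ}
    (hn : n ≤ k) : invGammaPair c (1 / 4 + n) = 0 := by
  obtain ⟨l, hl⟩ := Int.eq_ofNat_of_zero_le (sub_nonneg.2 hn)
  have hl' : (k : ℂ) - n = l := by exact_mod_cast hl
  have : Complex.Gamma (1 + c + (1 / 4 + n)) = 0 := by
    rw [show 1 + c + (1 / 4 + (n : ℂ)) = -(l : ℂ) by linear_combination hc - hl']
    exact Complex.Gamma_neg_nat_eq_zero l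
  rw [invGammaPair, this, zero_mul, inv_zero]

theorem invGammaPair_quarter_eq_zero_of_ge {c : ℂ} {k : ℤ} (hc : 1 / 4 - c = (k : ℂ)) {n : ℤ}
    (hn : 1 - k ≤ n) : invGammaPair c (1 / 4 + n) = 0 := by
  obtain ⟨l, hl⟩ := Int.eq_ofNat_of_zero_le (sub_nonneg.2 hn)
  have hl' : (n : ℂ) - (1 - k) = l := by exact_mod_cast hl
  have : Complex.Gamma (1 + c - (1 / 4 + n)) = 0 := by
    rw [show 1 + c - (1 / 4 + (n : ℂ)) = -(l : ℂ) by linear_combination -hc - hl']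
    exact Complex.Gamma_neg_nat_eq_zero l
  rw [invGammaPair, this, mul_zero, inv_zero]

/-- Generically this is the one-factor identity multiplied over j. At an exceptional parameter the
prefactor is 0, and well-definedness supplies a second parameter such that the zeros of the two
factors together cover all of 1/4 + ℤ. -/
theorem prod_invGammaPair_quarter_add_int (c : Fin m → ℂ)
    (hwd : BilateralWellDefined (fun j => 1 / 4 - c j) (fun j => 5 / 4 + c j)) (n : ℤ) :
    ∏ j, invGammaPair (c j) (1 / 4 + n) =
      1 / (∏ j, (Complex.Gamma (c j + 5 / 4) * Complex.Gamma (c j + 3 / 4))) *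
        bilateralTerm (fun j => 1 / 4 - c j) (fun j => 5 / 4 + c j) ((-1) ^ m) n := by
  obtain ⟨hwb, hwa⟩ := hwd
  by_cases hb : ∃ j, ∃ k : ℕ, 5 / 4 + c j = -(k : ℂ)
  · obtain ⟨j, k, hk⟩ := hb
    obtain ⟨i, l, hlk, hl⟩ := hwb j k hk
    have hz : Complex.Gamma (c j + 5 / 4) = 0 := by
      rw [add_comm, hk]; exact Complex.Gamma_neg_nat_eq_zero k
    have hprod : ∏ j, (Complex.Gamma (c j + 5 / 4) * Complex.Gamma (c j + 3 / 4)) = 0 :=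
      prod_eq_zero (mem_univ j) (by rw [hz, zero_mul])
    rw [hprod, div_zero, zero_mul]
    -- Factor j vanishes for n ≤ k and factor i for n ≥ l + 1; since l ≤ k, every n is covered.
    rcases le_or_gt n k with hn | hn
    · exact prod_eq_zero (mem_univ j) (invGammaPair_quarter_eq_zero_of_le hk hn)
    · refine prod_eq_zero (mem_univ i)
        (invGammaPair_quarter_eq_zero_of_ge (k := -(l : ℤ)) (by push_cast; exact hl) ?_)
      omega
  by_cases ha : ∃ j, ∃ k : ℕ, 1 ≤ k ∧ 1 / 4 - c j = (k : ℂ)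
  · obtain ⟨i, k, hk1, hk⟩ := ha
    obtain ⟨j, l, hl1, hlk, hl⟩ := hwa i k hk1 hk
    have hz : Complex.Gamma (c i + 3 / 4) = 0 := by
      obtain ⟨k, rfl⟩ := Nat.exists_eq_add_of_le' hk1
      rw [show c i + 3 / 4 = -(k : ℂ) by push_cast at hk; linear_combination -hk]
      exact Complex.Gamma_neg_nat_eq_zero k
    have hprod : ∏ j, (Complex.Gamma (c j + 5 / 4) * Complex.Gamma (c j + 3 / 4)) = 0 :=
      prod_eq_zero (mem_univ i) (by rw [hz, mul_zero])
    rw [hprod, div_zero, zero_mul]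
    -- Factor i vanishes for n ≥ 1 - k and factor j for n ≤ -l; again l ≤ k covers every n.
    rcases le_or_gt (1 - (k : ℤ)) n with hn | hn
    · exact prod_eq_zero (mem_univ i)
        (invGammaPair_quarter_eq_zero_of_ge (k := (k : ℤ)) (by exact_mod_cast hk) hn)
    · obtain ⟨r, hr⟩ := Int.eq_ofNat_of_zero_le (show 0 ≤ -n - l by omega)
      have hr' : -(n : ℂ) - l = r := by exact_mod_cast hr
      refine prod_eq_zero (mem_univ j) ?_
      have hl' : 5 / 4 + c j = (l : ℂ) := hl
      have : Complex.Gamma (1 + c j + (1 / 4 + n)) = 0 := by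
        rw [show 1 + c j + (1 / 4 + (n : ℂ)) = -(r : ℂ) by linear_combination hl' - hr']
        exact Complex.Gamma_neg_nat_eq_zero r
      rw [invGammaPair, this, zero_mul, inv_zero]
  push Not at ha hb
  rw [bilateralTerm_neg_one_pow, one_div (∏ j, _), ← prod_inv_distrib,
    ← prod_mul_distrib]
  exact prod_congr rfl fun j _ =>
    (shiftedFactorial_div_mul_eq_invGammaPair (c j) (hb j) (ha j) n).symm

theorem integral_inv_prod_Gamma_eq_bilateralH (hm : m ≤ 4) (c : Fin m → ℂ)
    (hc : 1 < m + 2 * (∑ j, c j).re)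
    (hwd : BilateralWellDefined (fun j => 1 / 4 - c j) (fun j => 5 / 4 + c j)) :
    MeasureTheory.Integrable (fun y : ℝ =>
      1 / ∏ j, (Complex.Gamma (1 + c j + (y : ℂ)) * Complex.Gamma (1 + c j - (y : ℂ)))) ∧
    Summable (bilateralTerm (fun j => 1 / 4 - c j) (fun j => 5 / 4 + c j) ((-1) ^ m)) ∧
    (∫ y : ℝ, 1 / ∏ j,
        (Complex.Gamma (1 + c j + (y : ℂ)) * Complex.Gamma (1 + c j - (y : ℂ)))) =
      1 / (∏ j, (Complex.Gamma (c j + 5 / 4) * Complex.Gamma (c j + 3 / 4))) *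
        bilateralH (fun j => 1 / 4 - c j) (fun j => 5 / 4 + c j) ((-1) ^ m) := by
  obtain ⟨C, K, hC, hF⟩ := exists_norm_prod_invGammaPair_le c
  have hd := differentiable_prod_invGammaPair c
  have hfun : (fun y : ℝ =>
      1 / ∏ j, (Complex.Gamma (1 + c j + (y : ℂ)) * Complex.Gamma (1 + c j - (y : ℂ))))
      = fun y : ℝ => ∏ j, invGammaPair (c j) y := by
    ext y
    rw [one_div, ← prod_inv_distrib]
    rfl
  have hm' : (m : ℝ) ≤ 4 := by exact_mod_cast hm
  refine ⟨?_, summable_bilateralTerm c hc, ?_⟩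
  · rw [hfun]
    exact integrable_ofReal_of_le_expTypeWeight hd hc hF
  · rw [hfun, ← tsum_quarter_add_int_eq_integral hd (fun z => by simp [invGammaPair_neg])
      (by positivity) (by nlinarith [Real.pi_pos]) hc hC hF, bilateralH, ← tsum_mul_left]
    exact tsum_congr fun n => prod_invGammaPair_quarter_add_int c hwd n

end BilateralIntegral

theorem theorem5p2 :
    (∀ c : Fin 3 → ℂ, 0 < (1 + c 0 + c 1 + c 2).re →
      BilateralWellDefined (fun j => 1 / 4 - c j) (fun j => 5 / 4 + c j) →
      MeasureTheory.Integrable (fun y : ℝ =>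
        1 / ∏ j, (Complex.Gamma (1 + c j + (y : ℂ)) * Complex.Gamma (1 + c j - (y : ℂ)))) ∧
      Summable (bilateralTerm (fun j => 1 / 4 - c j) (fun j => 5 / 4 + c j) (-1)) ∧
      (∫ y : ℝ, 1 / ∏ j,
          (Complex.Gamma (1 + c j + (y : ℂ)) * Complex.Gamma (1 + c j - (y : ℂ)))) =
        1 / (∏ j, (Complex.Gamma (c j + 5 / 4) * Complex.Gamma (c j + 3 / 4))) *
          bilateralH (fun j => 1 / 4 - c j) (fun j => 5 / 4 + c j) (-1)) ∧
    (∀ c : Fin 4 → ℂ, -(3 / 2) < (c 0 + c 1 + c 2 + c 3).re →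
      BilateralWellDefined (fun j => 1 / 4 - c j) (fun j => 5 / 4 + c j) →
      MeasureTheory.Integrable (fun y : ℝ =>
        1 / ∏ j, (Complex.Gamma (1 + c j + (y : ℂ)) * Complex.Gamma (1 + c j - (y : ℂ)))) ∧
      Summable (bilateralTerm (fun j => 1 / 4 - c j) (fun j => 5 / 4 + c j) 1) ∧
      (∫ y : ℝ, 1 / ∏ j,
          (Complex.Gamma (1 + c j + (y : ℂ)) * Complex.Gamma (1 + c j - (y : ℂ)))) =
        1 / (∏ j, (Complex.Gamma (c j + 5 / 4) * Complex.Gamma (c j + 3 / 4))) *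
          bilateralH (fun j => 1 / 4 - c j) (fun j => 5 / 4 + c j) 1) := by
  refine ⟨fun c hc hwd => ?_, fun c hc hwd => ?_⟩
  · have h := integral_inv_prod_Gamma_eq_bilateralH (by norm_num) c
      (by rw [Fin.sum_univ_three]; simp at hc ⊢; linarith) hwd
    rwa [show ((-1 : ℂ)) ^ 3 = -1 by norm_num] at h
  · have h := integral_inv_prod_Gamma_eq_bilateralH le_rfl c
      (by rw [Fin.sum_univ_four]; simp at hc ⊢; linarith) hwd
    rwa [show ((-1 : ℂ)) ^ 4 = 1 by norm_num] at h
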